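/- Let $\mathfrak c=2^{\aleph_0}$, and let the pseudointersection number $\mathfrak p$ be the least cardinality of a family $\mathcal F$ of subsets of $\omega$ such that every intersection of finitely many members of $\mathcal F$ is infinite, but there is no infinite $B\subset\omega$ with $B\setminus A$ finite for all $A\in\mathcal F$. A group is Boolean if each of its elements is its own inverse. A subset $A$ of a group $G$ is called $\kappa$-fat, for a cardinal $\kappa$, if every set $S\subset G$ with $|S|=\kappa$ contains a two-element subset $D$ such that $D^{-1}D\subset A$; it is called fat if it is $m$-fat for some positive integer $m$. For $\kappa\le\omega$, $A$ is called a right (left) $\Delta^*_\kappa$-set if, for every one-to-one sequence $(g_n)_{n\in\kappa}$ in $G$, there exist $m<n<\kappa$ with $g_m^{-1}g_n\in A$ (respectively, $g_ng_m^{-1}\in A$). In a Boolean group the right and left notions coincide, and one speaks simply of $\Delta^*_\kappa$-sets; $\Delta^*_\omega$-sets are called $\Delta^*$-sets. **Corollary.** Assume that $\mathfrak p=\mathfrak c$. Then every infinite Boolean group contains an $\omega$-fat set which is not fat. It also contains a $\Delta^*$-set which is not a $\Delta^*_k$-set for any finite $k$. -/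

import Mathlib

open scoped Pointwise Cardinal

namespace LargeSets

/-- A Boolean group: every element is its own inverse. -/
def IsBooleanGroup (G : Type*) [Group G] : Prop :=
  ∀ g : G, g⁻¹ = g

/-- `A` is `κ`-fat in `G`: every set `S ⊆ G` with `|S| = κ` contains a two-element
subset `D` for which `D⁻¹D ⊆ A`. -/
def IsCardFat {G : Type*} [Group G] (κ : Cardinal) (A : Set G) : Prop :=
  ∀ S : Set G, #S = κ → ∃ D : Set G, D ⊆ S ∧ D.ncard = 2 ∧ D⁻¹ * D ⊆ A

/-- `A` is fat in `G`: for some positive integer `m`, every `m`-element set `F ⊆ G` contains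
a two-element subset `D` for which `D⁻¹D ⊆ A`. -/
def IsFat {G : Type*} [Group G] (A : Set G) : Prop :=
  ∃ m : ℕ, 0 < m ∧ IsCardFat (m : Cardinal) A

/-- The indices of a sequence `(g_n)_{n ∈ κ}`, where `κ` is finite or `ω` (that is, `κ = ⊤`). -/
abbrev Index (κ : ℕ∞) : Type := {n : ℕ // (n : ℕ∞) < κ}

/-- The set of all products `g_m⁻¹ g_n` with `m < n < κ`. -/
def deltaI {G : Type*} [Group G] {κ : ℕ∞} (g : Index κ → G) : Set G :=
  {x | ∃ m n : Index κ, m < n ∧ x = (g m)⁻¹ * g n}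

/-- The set of all products `g_n g_m⁻¹` with `m < n < κ`. -/
def deltaD {G : Type*} [Group G] {κ : ℕ∞} (g : Index κ → G) : Set G :=
  {x | ∃ m n : Index κ, m < n ∧ x = g n * (g m)⁻¹}

/-- Right `Δ*_κ`-sets. -/
def IsRightDeltaStar {G : Type*} [Group G] (κ : ℕ∞) (A : Set G) : Prop :=
  ∀ g : Index κ → G, Function.Injective g → (A ∩ deltaI g).Nonempty

/-- Left `Δ*_κ`-sets. -/
def IsLeftDeltaStar {G : Type*} [Group G] (κ : ℕ∞) (A : Set G) : Prop :=
  ∀ g : Index κ → G, Function.Injective g → (A ∩ deltaD g).Nonempty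

/-- The strong finite intersection property: all finite intersections of members of the family
are infinite, i.e. the family generates a filter on `ω` all of whose elements are infinite. -/
def HasSFIP (F : Set (Set ℕ)) : Prop :=
  ∀ s : Set (Set ℕ), s ⊆ F → s.Finite → (⋂₀ s).Infinite

/-- `B` is a pseudointersection of `F`: it is almost contained in every member of `F`. -/
def IsPseudointersection (F : Set (Set ℕ)) (B : Set ℕ) : Prop :=
  ∀ A ∈ F, (B \ A).Finite

/-- The pseudointersection number `𝔭`: the least size of a family of subsets of `ω` with the
strong finite intersection property and without infinite pseudointersection. -/
noncomputable def pseudointersectionNumber : Cardinal.{0} :=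
  sInf {κ : Cardinal.{0} | ∃ F : Set (Set ℕ), HasSFIP F ∧
    (¬ ∃ B : Set ℕ, B.Infinite ∧ IsPseudointersection F B) ∧ #F = κ}

end LargeSets

/-!
For a Boolean group `G`, the complement of a set `C ∌ 1` is `ω`-fat (equivalently, a `Δ*`-set) if
and only if the Cayley graph of `G` with connection set `C` has no infinite clique, and it is
`m`-fat (equivalently, a `Δ*_m`-set) if and only if that graph has no clique of size `m`. So it
suffices to find `C` whose Cayley graph has arbitrarily large finite cliques but no infinite one.

Regard `G` as an infinite vector space over the field with two elements and let `H 0, H 1, …` be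
finite subspaces spanned by disjoint parts of a basis, the `n`-th part having `n` elements. Take
`C = ⋃ n, H n \ {0}`. The basis vectors in `H n` form a clique of size `n`. A clique can be
translated so as to contain `0`, and then its other points lie in `C`; by independence, the
difference of nonzero elements of different `H n` and `H m` is in no `H k`, so all these points lie
in a single finite `H n`. This is `LargeSets.exists_large_finite_cliques_no_infinite_clique`.
-/

namespace LargeSets

open Submodule

/-- An infinite vector space over a finite field has a linearly independent family indexed by
`ℕ × ℕ`. -/
theorem exists_linearIndependent_nat_prod (K V : Type*) [Field K] [Finite K] [AddCommGroup V]
    [Module K V] [Infinite V] : ∃ e : ℕ × ℕ → V, LinearIndependent K e := by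
  let b := Module.Basis.ofVectorSpace K V
  have hι : Infinite (Module.Basis.ofVectorSpaceIndex K V) := by
    by_contra h
    rw [not_infinite_iff_finite] at h
    have : Module.Finite K V := .of_basis b
    have : Finite V := Module.finite_of_finite K
    exact not_finite V
  exact ⟨_, b.linearIndependent.comp (Infinite.natEmbedding _ ∘ Nat.pairEquiv)
    ((Infinite.natEmbedding _).injective.comp Nat.pairEquiv.injective)⟩

/-- If `x` and `y` are vectors from the spans of two different rows of a linearly independent
family and `y - x` lies in the span of a row, then one of `x`, `y` vanishes. -/
theorem eq_zero_or_eq_zero_of_sub_mem_span {K V ι κ : Type*} [Field K] [AddCommGroup V]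
    [Module K V] {e : ι × κ → V} (he : LinearIndependent K e) {a b k : ι} (hab : a ≠ b) {x y : V}
    (hx : x ∈ span K (e '' {p | p.1 = a})) (hy : y ∈ span K (e '' {p | p.1 = b}))
    (hxy : y - x ∈ span K (e '' {p | p.1 = k})) : x = 0 ∨ y = 0 := by
  have hd {i j : ι} (hij : i ≠ j) :
      Disjoint (span K (e '' {p | p.1 = i})) (span K (e '' {p | p.1 = j})) :=
    he.disjoint_span_image (Set.disjoint_left.2 fun p hp hq => hij (hp.symm.trans hq))
  by_cases hka : k = a
  · subst hka
    exact .inr (disjoint_def.1 (hd hab) y (by simpa using add_mem hxy hx) hy)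
  by_cases hkb : k = b
  · subst hkb
    exact .inl (disjoint_def.1 (hd hab) x hx (by simpa using sub_mem hy hxy))
  have hk : Disjoint (span K (e '' {p | p.1 = k})) (span K (e '' ({p | p.1 = a} ∪ {p | p.1 = b}))) :=
    he.disjoint_span_image (Set.disjoint_left.2 fun p hp hq =>
      hq.elim (fun h => hka (hp.symm.trans h)) fun h => hkb (hp.symm.trans h))
  have h0 : y - x = 0 := by
    refine disjoint_def.1 hk _ hxy (sub_mem ?_ ?_)
    · exact span_mono (Set.image_mono Set.subset_union_right) hy
    · exact span_mono (Set.image_mono Set.subset_union_left) hx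
  rw [sub_eq_zero] at h0
  subst h0
  exact .inl (disjoint_def.1 (hd hab) _ hx hy)

/-- An infinite vector space over a finite field has a Cayley graph with arbitrarily large finite
cliques but without infinite cliques. -/
theorem exists_large_finite_cliques_no_infinite_clique (K V : Type*) [Field K] [Finite K]
    [AddCommGroup V] [Module K V] [Infinite V] :
    ∃ C : Set V, 0 ∉ C ∧
      (∀ g : ℕ → V, Function.Injective g → ∃ m n, m < n ∧ -g m + g n ∉ C) ∧
      ∀ k : ℕ, ∃ g : Fin k → V, Function.Injective g ∧ ∀ i j, i ≠ j → -g i + g j ∈ C := by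
  obtain ⟨e, he⟩ := exists_linearIndependent_nat_prod K V
  let H (n : ℕ) : Submodule K V := span K ((fun i => e (n, i)) '' Set.Iio n)
  have hH (n : ℕ) : H n ≤ span K (e '' {p | p.1 = n}) :=
    span_mono (by rintro _ ⟨i, -, rfl⟩; exact ⟨(n, i), rfl, rfl⟩)
  refine ⟨{x | x ≠ 0 ∧ ∃ n, x ∈ H n}, fun h => h.1 rfl, fun g hg => ?_, fun k => ?_⟩
  · by_contra! hC
    obtain ⟨h0, a, ha⟩ := hC 0 1 one_pos
    have hmem (n : ℕ) : -g 0 + g (n + 2) ∈ H a := by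
      obtain ⟨hn, b, hb⟩ := hC 0 (n + 2) (by omega)
      obtain ⟨-, k, hk⟩ := hC 1 (n + 2) (by omega)
      by_contra hna
      have hab : a ≠ b := by rintro rfl; exact hna hb
      rcases eq_zero_or_eq_zero_of_sub_mem_span he hab (hH a ha) (hH b hb)
        (k := k) (by convert hH k hk using 1; abel) with h | h
      · exact h0 h
      · exact hn h
    have : Module.Finite K (H a) :=
      Module.Finite.span_of_finite K ((Set.finite_Iio a).image _)
    have : Finite (H a) := Module.finite_of_finite K
    refine not_injective_infinite_finite (fun n : ℕ => (⟨_, hmem n⟩ : H a)) fun m n h => ?_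
    have := hg (add_left_cancel (congrArg Subtype.val h))
    omega
  · have hinj : Function.Injective fun i : Fin k => e (k, i) := fun i j h =>
      Fin.ext (congrArg Prod.snd (he.injective h))
    have hmem (i : Fin k) : e (k, i) ∈ H k := subset_span ⟨i, i.2, rfl⟩
    refine ⟨_, hinj, fun i j hij => ⟨fun h => hij (hinj (neg_add_eq_zero.1 h)), k, ?_⟩⟩
    exact add_mem (neg_mem (hmem i)) (hmem j)

/-- An infinite Boolean group has a Cayley graph with arbitrarily large finite cliques but without
infinite cliques. -/
theorem IsBooleanGroup.exists_large_finite_cliques_no_infinite_clique {G : Type*} [Group G]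
    [Infinite G] (hG : IsBooleanGroup G) :
    ∃ C : Set G, 1 ∉ C ∧
      (∀ g : ℕ → G, Function.Injective g → ∃ m n, m < n ∧ (g m)⁻¹ * g n ∉ C) ∧
      ∀ k : ℕ, ∃ g : Fin k → G, Function.Injective g ∧ ∀ i j, i ≠ j → (g i)⁻¹ * g j ∈ C := by
  let _ : CommGroup G :=
    { (inferInstance : Group G) with
      mul_comm := fun a b => by rw [← hG (a * b), mul_inv_rev, hG a, hG b] }
  let _ : Module (ZMod 2) (Additive G) := AddCommGroup.zmodModule fun x => by
    rw [two_nsmul, ← eq_neg_iff_add_eq_zero]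
    exact (hG x.toMul).symm
  have : Infinite (Additive G) := ‹Infinite G›
  exact LargeSets.exists_large_finite_cliques_no_infinite_clique (ZMod 2) (Additive G)

theorem IsBooleanGroup.mul_inv_eq {G : Type*} [Group G] (hG : IsBooleanGroup G) (x y : G) :
    y * x⁻¹ = x⁻¹ * y := by
  rw [← hG (y * x⁻¹), mul_inv_rev, inv_inv, hG y, hG x]

theorem IsBooleanGroup.deltaD_eq_deltaI {G : Type*} [Group G] (hG : IsBooleanGroup G) {κ : ℕ∞}
    (g : Index κ → G) : deltaD g = deltaI g := by
  simp only [deltaD, deltaI, hG.mul_inv_eq]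

theorem IsBooleanGroup.isLeftDeltaStar_iff {G : Type*} [Group G] (hG : IsBooleanGroup G) {κ : ℕ∞}
    {A : Set G} : IsLeftDeltaStar κ A ↔ IsRightDeltaStar κ A := by
  simp only [IsLeftDeltaStar, IsRightDeltaStar, hG.deltaD_eq_deltaI]

theorem IsBooleanGroup.isCardFat_aleph0_compl {G : Type*} [Group G] (hG : IsBooleanGroup G)
    {C : Set G} (h1 : 1 ∉ C)
    (hC : ∀ g : ℕ → G, Function.Injective g → ∃ m n, m < n ∧ (g m)⁻¹ * g n ∉ C) :
    IsCardFat Cardinal.aleph0 Cᶜ := by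
  intro S hS
  have : Infinite S := Cardinal.infinite_iff.2 hS.ge
  let f := Infinite.natEmbedding S
  obtain ⟨m, n, hmn, h⟩ := hC (fun n => f n) (Subtype.val_injective.comp f.injective)
  have hne : (f m : G) ≠ f n := fun h => hmn.ne (f.injective (Subtype.ext h))
  refine ⟨{(f m : G), (f n : G)}, ?_, Set.ncard_pair hne, ?_⟩
  · rintro _ (rfl | rfl) <;> exact Subtype.coe_prop _
  · -- The inverse of a pairwise product is that product itself, so the order is immaterial.
    have h' : (f n : G)⁻¹ * f m ∉ C := by
      rwa [← hG (_ * _), mul_inv_rev, inv_inv]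
    rw [Set.inv_insert, Set.inv_singleton]
    rintro _ ⟨_, rfl | rfl, _, rfl | rfl, rfl⟩ <;> simpa

theorem not_isFat_compl {G : Type*} [Group G] {C : Set G}
    (hC : ∀ k : ℕ, ∃ g : Fin k → G, Function.Injective g ∧ ∀ i j, i ≠ j → (g i)⁻¹ * g j ∈ C) :
    ¬ IsFat Cᶜ := by
  rintro ⟨m, -, hm⟩
  obtain ⟨g, hg, hgC⟩ := hC m
  obtain ⟨D, hDS, hD, hDA⟩ := hm (Set.range g) (by
    have := Cardinal.mk_range_eq_of_injective hg
    simpa using this)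
  obtain ⟨x, y, hxy, rfl⟩ := Set.ncard_eq_two.1 hD
  obtain ⟨i, rfl⟩ := hDS (Set.mem_insert x _)
  obtain ⟨j, rfl⟩ := hDS (Set.mem_insert_of_mem _ rfl)
  refine hDA (Set.mul_mem_mul (a := (g i)⁻¹) (b := g j) ?_ ?_) (hgC i j (ne_of_apply_ne g hxy))
  · simp
  · simp

theorem isRightDeltaStar_top_compl {G : Type*} [Group G] {C : Set G}
    (hC : ∀ g : ℕ → G, Function.Injective g → ∃ m n, m < n ∧ (g m)⁻¹ * g n ∉ C) :
    IsRightDeltaStar ⊤ Cᶜ := by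
  intro g hg
  obtain ⟨m, n, hmn, h⟩ := hC (fun n => g ⟨n, ENat.natCast_lt_top n⟩) fun m n h =>
    congrArg Subtype.val (hg h)
  exact ⟨_, h, _, _, hmn, rfl⟩

theorem not_isRightDeltaStar_compl {G : Type*} [Group G] {C : Set G} {k : ℕ}
    (hC : ∃ g : Fin k → G, Function.Injective g ∧ ∀ i j, i ≠ j → (g i)⁻¹ * g j ∈ C) :
    ¬ IsRightDeltaStar (k : ℕ∞) Cᶜ := by
  obtain ⟨g, hg, hgC⟩ := hC
  intro h
  obtain ⟨_, hx, m, n, hmn, rfl⟩ := h (fun i => g ⟨i, Nat.cast_lt.1 i.2⟩) fun m n h =>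
    Subtype.ext (congrArg Fin.val (hg h))
  exact hx (hgC _ _ fun h => hmn.ne (Subtype.ext (congrArg Fin.val h)))

end LargeSets

theorem mainTheorem7
    (hp : LargeSets.pseudointersectionNumber = Cardinal.continuum.{0})
    {G : Type*} [Group G] [Infinite G] (hG : LargeSets.IsBooleanGroup G) :
    (∃ A : Set G, LargeSets.IsCardFat Cardinal.aleph0 A ∧ ¬ LargeSets.IsFat A) ∧
    (∃ A : Set G,
      (LargeSets.IsRightDeltaStar ⊤ A ∧ LargeSets.IsLeftDeltaStar ⊤ A) ∧
      ∀ k : ℕ, ¬ LargeSets.IsRightDeltaStar (k : ℕ∞) A ∧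
        ¬ LargeSets.IsLeftDeltaStar (k : ℕ∞) A) := by
  obtain ⟨C, h1, hinf, hfin⟩ := hG.exists_large_finite_cliques_no_infinite_clique
  have htop := LargeSets.isRightDeltaStar_top_compl hinf
  have hk (k : ℕ) := LargeSets.not_isRightDeltaStar_compl (hfin k)
  exact ⟨⟨Cᶜ, hG.isCardFat_aleph0_compl h1 hinf, LargeSets.not_isFat_compl hfin⟩,
    Cᶜ, ⟨htop, hG.isLeftDeltaStar_iff.2 htop⟩,
    fun k => ⟨hk k, fun h => hk k (hG.isLeftDeltaStar_iff.1 h)⟩⟩
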